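/- Let $X$ and $Y$ be compact Hausdorff spaces and let $f\colon X\to Y$ be a surjective ring-like map, i.e. a continuous closed surjection such that for every point $x\in X$ and all open sets $U\subset X$, $V\subset Y$ with $x\in U$ and $f(x)\in V$ there is an open set $V'\subset Y$ with $f(x)\in V'\subset V$ and $f^{-1}(\operatorname{Fr} V')\subset U$, where $\operatorname{Fr}$ denotes the boundary. Let $\dim$ denote the covering dimension and $\operatorname{ind}$ the small inductive dimension, both with values in $\{-1,0,1,2,\dots,\infty\}$. Suppose that $\dim Y\ge 1$, let $m\in\{0,1,2,\dots,\infty\}$, and suppose that $\operatorname{ind} f^{-1}(y)\ge m$ for every $y\in Y$. Then $$\operatorname{ind} X\ \ge\ \dim Y+m-1 ,$$ with the usual conventions for $\infty$ (the right-hand side is $\infty$ if $\dim Y=\infty$ or $m=\infty$). -/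

import Mathlib

open Set Topology

/-- `dim X < n` for the Lebesgue covering dimension (that is, `dim X ≤ n - 1`): every finite open
cover of `X` has a finite open refinement which covers `X` and in which every point lies in at most
`n` members. In particular `dim X < 0` means that `X` is empty. -/
def HasCoveringDimensionLT (X : Type*) [TopologicalSpace X] (n : ℕ) : Prop :=
  ∀ 𝒰 : Set (Set X), 𝒰.Finite → (∀ U ∈ 𝒰, IsOpen U) → ⋃₀ 𝒰 = univ →
    ∃ 𝒱 : Set (Set X), 𝒱.Finite ∧ (∀ V ∈ 𝒱, IsOpen V) ∧ ⋃₀ 𝒱 = univ ∧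
      (∀ V ∈ 𝒱, ∃ U ∈ 𝒰, V ⊆ U) ∧ ∀ x : X, {V ∈ 𝒱 | x ∈ V}.encard ≤ n

/-- The Lebesgue covering dimension, with values in `{-1, 0, 1, 2, …, ∞}`; the value `-1` is
represented by `⊥`, as for `smallInductiveDimension`. -/
noncomputable def coveringDimension (X : Type*) [TopologicalSpace X] : WithBot ℕ∞ :=
  sInf {n | ∀ i : ℕ, n < i → HasCoveringDimensionLT X i}

/-- A closed continuous map `f : X → Y` is ring-like if for every point `x` and all open sets
`U ∋ x` and `V ∋ f x`, there is an open set `V' ∋ f x` such that `V' ⊆ V` and the preimage of the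
frontier of `V'` is contained in `U`. -/
structure IsRingLike {X Y : Type*} [TopologicalSpace X] [TopologicalSpace Y] (f : X → Y) :
    Prop where
  continuous : Continuous f
  isClosedMap : IsClosedMap f
  exists_isOpen : ∀ (x : X) (U : Set X) (V : Set Y), IsOpen U → x ∈ U → IsOpen V → f x ∈ V →
    ∃ V' : Set Y, IsOpen V' ∧ f x ∈ V' ∧ V' ⊆ V ∧ f ⁻¹' frontier V' ⊆ U

/-!
The proof is by induction on `n = dim Y ≥ 1`; for `n = 1` the bound holds because `X` contains a
fibre.

Let `dim Y ≥ n ≥ 2`. If every point of `Y` had arbitrarily small open neighbourhoods whose frontiers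
have dimension `≤ n - 2`, then `dim Y ≤ n - 1` (`coverDimLT_univ_succ_of_frontier`, which rests on
the sum theorem `CoverDimLT.union`). So there are `y` and an open `V ∋ y` such that every
neighbourhood of `y` inside `V` has a frontier of dimension `≥ n - 1`. Take `x` over `y` and any open
`U` with `x ∈ U ⊆ f⁻¹(V)`, and let `P` be the closed set of the points of `Y` whose fibres lie
neither in `U` nor in the exterior of `U`. The ring-like condition at `x` gives a neighbourhood of
`y` inside `V` whose frontier lies in `P`, so `dim P ≥ n - 1`. The dimension of a compact space is
attained on its components (`coverDimLT_univ_of_connectedComponent`), so `P` has a component `C` with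
`dim C ≥ n - 1 ≥ 1`; in particular `C` has more than one point. The ring-like condition then forces
`f⁻¹(C) ⊆ Fr U` (`IsRingLike.preimage_subset_frontier`). The restriction `f⁻¹(C) → C` is again
ring-like, so by induction `ind Fr U ≥ ind f⁻¹(C) ≥ (n - 1) + m - 1`. As `U` was arbitrary,
`ind X ≥ n + m - 1`.
-/

universe u v

/-! ### Covering dimension of subsets -/

/-- `S` has covering dimension `< n`, expressed inside the ambient space: every finite family of
open sets of `X` covering `S` can be shrunk, index by index, to an open family which still covers
`S` and in which every point of `S` lies in at most `n` members. -/
def CoverDimLT {X : Type u} [TopologicalSpace X] (S : Set X) (n : ℕ) : Prop :=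
  ∀ (ι : Type u) [Finite ι] (U : ι → Set X), (∀ i, IsOpen (U i)) → S ⊆ ⋃ i, U i →
    ∃ V : ι → Set X, (∀ i, IsOpen (V i)) ∧ (∀ i, V i ⊆ U i) ∧ S ⊆ ⋃ i, V i ∧
      ∀ x ∈ S, {i | x ∈ V i}.encard ≤ n

theorem HasCoveringDimensionLT.mono {X : Type*} [TopologicalSpace X] {m n : ℕ} (hmn : m ≤ n)
    (h : HasCoveringDimensionLT X m) : HasCoveringDimensionLT X n := by
  intro 𝒰 h1 h2 h3
  obtain ⟨𝒱, a, b, c, d, e⟩ := h 𝒰 h1 h2 h3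
  exact ⟨𝒱, a, b, c, d, fun x => (e x).trans (by exact_mod_cast hmn)⟩

theorem coveringDimension_lt_of_hasCoveringDimensionLT {X : Type*} [TopologicalSpace X] {n : ℕ}
    (h : HasCoveringDimensionLT X n) : coveringDimension X < n := by
  cases n with
  | zero =>
    have hb : coveringDimension X ≤ ⊥ := sInf_le fun i _ => h.mono (Nat.zero_le i)
    exact hb.trans_lt (WithBot.bot_lt_coe _)
  | succ n =>
    have hb : coveringDimension X ≤ (n : WithBot ℕ∞) := by
      refine sInf_le fun i hi => h.mono ?_
      have : n < i := by exact_mod_cast hi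
      exact this
    refine hb.trans_lt ?_
    exact_mod_cast n.lt_add_one

section Cover

variable {X : Type u} [TopologicalSpace X]

theorem CoverDimLT.mono {S : Set X} {m n : ℕ} (hmn : m ≤ n) (h : CoverDimLT S m) :
    CoverDimLT S n := by
  intro ι _ U hU hS
  obtain ⟨V, a, b, c, d⟩ := h ι U hU hS
  exact ⟨V, a, b, c, fun x hx => (d x hx).trans (by exact_mod_cast hmn)⟩

theorem CoverDimLT.hasCoveringDimensionLT {n : ℕ} (h : CoverDimLT (univ : Set X) n) :
    HasCoveringDimensionLT X n := by
  intro 𝒰 hfin hopen hcov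
  have := hfin.to_subtype
  obtain ⟨V, hVo, hVU, hVc, hVn⟩ := h 𝒰 (fun U => U.1) (fun U => hopen U.1 U.2)
    (by rw [← sUnion_eq_iUnion, hcov])
  refine ⟨range V, finite_range V, ?_, ?_, ?_, fun x => ?_⟩
  · rintro _ ⟨i, rfl⟩
    exact hVo i
  · rw [sUnion_range]
    exact univ_subset_iff.1 hVc
  · rintro _ ⟨i, rfl⟩
    exact ⟨i.1, i.2, hVU i⟩
  · have hsub : {W ∈ range V | x ∈ W} ⊆ V '' {i | x ∈ V i} := by
      rintro _ ⟨⟨i, rfl⟩, hx⟩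
      exact ⟨i, hx, rfl⟩
    exact (encard_le_encard hsub).trans ((encard_image_le _ _).trans (hVn x (mem_univ x)))

theorem HasCoveringDimensionLT.coverDimLT_univ {n : ℕ} (h : HasCoveringDimensionLT X n) :
    CoverDimLT (univ : Set X) n := by
  intro ι _ U hU hcov
  obtain ⟨𝒱, -, hVo, hVc, hVU, hVn⟩ := h (range U) (finite_range U)
    (by rintro _ ⟨i, rfl⟩; exact hU i) (by rw [sUnion_range]; exact univ_subset_iff.1 hcov)
  have hr : ∀ W : 𝒱, ∃ i, W.1 ⊆ U i := by
    intro W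
    obtain ⟨_, ⟨i, rfl⟩, hi⟩ := hVU W.1 W.2
    exact ⟨i, hi⟩
  choose r hr using hr
  -- Members of the refinement lying in the same `U i` are merged into one set.
  refine ⟨fun i => ⋃ W : {W : 𝒱 // r W = i}, W.1.1, fun i => isOpen_iUnion fun W => hVo _ W.1.2,
    fun i => iUnion_subset ?_, fun x _ => ?_, fun x _ => ?_⟩
  · rintro ⟨W, rfl⟩
    exact hr W
  · obtain ⟨W, hW, hx⟩ := hVc.symm.subset (mem_univ x)
    exact mem_iUnion.2 ⟨r ⟨W, hW⟩, mem_iUnion.2 ⟨⟨⟨W, hW⟩, rfl⟩, hx⟩⟩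
  · have hsub : {i | x ∈ ⋃ W : {W : 𝒱 // r W = i}, W.1.1} ⊆ r '' {W : 𝒱 | x ∈ W.1} := by
      intro i hi
      obtain ⟨⟨W, hW⟩, hx⟩ := mem_iUnion.1 hi
      exact ⟨W, hx, hW⟩
    refine (encard_le_encard hsub).trans ((encard_image_le _ _).trans ?_)
    refine le_trans (le_of_eq ?_) (hVn x)
    rw [← Subtype.val_injective.encard_image]
    congr 1
    ext W
    simp [and_comm]

theorem hasCoveringDimensionLT_iff_coverDimLT_univ {n : ℕ} :
    HasCoveringDimensionLT X n ↔ CoverDimLT (univ : Set X) n :=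
  ⟨fun h => h.coverDimLT_univ, fun h => h.hasCoveringDimensionLT⟩

theorem Topology.IsInducing.coverDimLT_image_iff {Z : Type u} [TopologicalSpace Z] {e : Z → X}
    (he : IsInducing e) {S : Set Z} {n : ℕ} : CoverDimLT (e '' S) n ↔ CoverDimLT S n := by
  constructor
  · intro h ι _ U hU hS
    choose O hO hOU using fun i => he.isOpen_iff.1 (hU i)
    obtain ⟨V, hVo, hVO, hVc, hVn⟩ := h ι O hO (by
      rintro _ ⟨z, hz, rfl⟩
      obtain ⟨i, hi⟩ := mem_iUnion.1 (hS hz)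
      rw [← hOU i] at hi
      exact mem_iUnion.2 ⟨i, hi⟩)
    refine ⟨fun i => e ⁻¹' V i, fun i => (hVo i).preimage he.continuous, fun i => ?_,
      fun z hz => ?_, fun z hz => hVn (e z) (mem_image_of_mem e hz)⟩
    · rw [← hOU i]
      exact preimage_mono (hVO i)
    · obtain ⟨i, hi⟩ := mem_iUnion.1 (hVc (mem_image_of_mem e hz))
      exact mem_iUnion.2 ⟨i, hi⟩
  · intro h ι _ U hU hS
    obtain ⟨V, hVo, hVU, hVc, hVn⟩ := h ι (fun i => e ⁻¹' U i)
      (fun i => (hU i).preimage he.continuous) (by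
        intro z hz
        obtain ⟨i, hi⟩ := mem_iUnion.1 (hS (mem_image_of_mem e hz))
        exact mem_iUnion.2 ⟨i, hi⟩)
    choose O hO hOV using fun i => he.isOpen_iff.1 (hVo i)
    have hmem : ∀ i z, e z ∈ O i ∩ U i ↔ z ∈ V i := by
      intro i z
      rw [← hOV i]
      refine ⟨fun h => h.1, fun h => ⟨h, hVU i ?_⟩⟩
      rw [← hOV i]
      exact h
    refine ⟨fun i => O i ∩ U i, fun i => (hO i).inter (hU i), fun i => inter_subset_right, ?_, ?_⟩
    · rintro _ ⟨z, hz, rfl⟩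
      obtain ⟨i, hi⟩ := mem_iUnion.1 (hVc hz)
      exact mem_iUnion.2 ⟨i, (hmem i z).2 hi⟩
    · rintro _ ⟨z, hz, rfl⟩
      simp only [hmem]
      exact hVn z hz

theorem hasCoveringDimensionLT_coe_iff {S : Set X} {n : ℕ} :
    HasCoveringDimensionLT S n ↔ CoverDimLT S n := by
  rw [hasCoveringDimensionLT_iff_coverDimLT_univ, ← IsInducing.subtypeVal.coverDimLT_image_iff,
    image_univ, Subtype.range_coe]

theorem CoverDimLT.of_subset {S T : Set X} {n : ℕ} (h : CoverDimLT S n) (hTS : T ⊆ S)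
    (hT : IsClosed T) : CoverDimLT T n := by
  intro ι _ U hU hc
  -- The open set `Tᶜ` completes the given family to a cover of `S`.
  obtain ⟨V, hVo, hVU, hVc, hVn⟩ := h (Option ι) (fun o => o.elim Tᶜ U)
    (by rintro (_ | i); exacts [hT.isOpen_compl, hU i]) (by
      intro x _
      by_cases hx : x ∈ T
      · obtain ⟨i, hi⟩ := mem_iUnion.1 (hc hx)
        exact mem_iUnion.2 ⟨some i, hi⟩
      · exact mem_iUnion.2 ⟨none, hx⟩)
  refine ⟨fun i => V (some i), fun i => hVo _, fun i => hVU (some i), fun x hx => ?_,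
    fun x hx => ?_⟩
  · obtain ⟨_ | i, hi⟩ := mem_iUnion.1 (hVc (hTS hx))
    · exact absurd hx (hVU none hi)
    · exact mem_iUnion.2 ⟨i, hi⟩
  · refine le_trans ?_ (hVn x (hTS hx))
    rw [← (Option.some_injective ι).encard_image]
    refine encard_le_encard ?_
    rintro _ ⟨i, hi, rfl⟩
    exact hi

theorem Set.Subsingleton.coverDimLT {S : Set X} (hS : S.Subsingleton) : CoverDimLT S 1 := by
  intro ι _ U hU hc
  rcases hS.eq_empty_or_singleton with rfl | ⟨x, rfl⟩
  · exact ⟨U, hU, fun i => Subset.rfl, hc, by simp⟩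
  · obtain ⟨i, hi⟩ := mem_iUnion.1 (hc (mem_singleton x))
    refine ⟨fun j => {z ∈ U j | j = i}, fun j => ?_, fun j => sep_subset _ _, ?_, fun z _ => ?_⟩
    · by_cases hj : j = i
      · simpa [hj] using hU i
      · simp [hj]
    · rintro _ rfl
      exact mem_iUnion.2 ⟨i, hi, rfl⟩
    · rw [Nat.cast_one, encard_le_one_iff]
      rintro a b ⟨-, rfl⟩ ⟨-, rfl⟩
      rfl

/-- The sum theorem for two closed sets. -/
theorem CoverDimLT.union {S T : Set X} {n : ℕ} (hSn : CoverDimLT S n) (hTn : CoverDimLT T n)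
    (hS : IsClosed S) (hT : IsClosed T) : CoverDimLT (S ∪ T) n := by
  -- Shrinking a cover over one closed set does not change it off that set.
  have key : ∀ {A : Set X}, IsClosed A → CoverDimLT A n → ∀ (ι : Type u) [Finite ι]
      (U : ι → Set X), (∀ i, IsOpen (U i)) → S ∪ T ⊆ ⋃ i, U i → A ⊆ S ∪ T →
      ∃ V : ι → Set X, (∀ i, IsOpen (V i)) ∧ (∀ i, V i ⊆ U i) ∧ S ∪ T ⊆ ⋃ i, V i ∧
        ∀ x ∈ A, {i | x ∈ V i}.encard ≤ n := by
    intro A hA hAn ι _ U hU hc hAST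
    obtain ⟨V, hVo, hVU, hVc, hVn⟩ := hAn ι U hU (hAST.trans hc)
    refine ⟨fun i => V i ∪ U i \ A, fun i => (hVo i).union ((hU i).sdiff hA),
      fun i => union_subset (hVU i) sdiff_subset, fun x hx => ?_, fun x hx => ?_⟩
    · by_cases hxA : x ∈ A
      · obtain ⟨i, hi⟩ := mem_iUnion.1 (hVc hxA)
        exact mem_iUnion.2 ⟨i, Or.inl hi⟩
      · obtain ⟨i, hi⟩ := mem_iUnion.1 (hc hx)
        exact mem_iUnion.2 ⟨i, Or.inr ⟨hi, hxA⟩⟩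
    · refine (encard_le_encard ?_).trans (hVn x hx)
      rintro i (hi | hi)
      exacts [hi, absurd hx hi.2]
  intro ι _ U hU hc
  obtain ⟨V, hVo, hVU, hVc, hVn⟩ := key hS hSn ι U hU hc subset_union_left
  obtain ⟨W, hWo, hWV, hWc, hWn⟩ := key hT hTn ι V hVo hVc subset_union_right
  refine ⟨W, hWo, fun i => (hWV i).trans (hVU i), hWc, ?_⟩
  rintro x (hx | hx)
  · exact (encard_le_encard fun i hi => hWV i hi).trans (hVn x hx)
  · exact hWn x hx

/-- Over a closed subset of a normal space the shrinking can be chosen with its multiplicity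
bounded at every point of the ambient space. -/
theorem CoverDimLT.exists_forall_encard_le [NormalSpace X] {S : Set X} {n : ℕ}
    (h : CoverDimLT S n) (hS : IsClosed S) {ι : Type u} [Finite ι] (U : ι → Set X)
    (hU : ∀ i, IsOpen (U i)) (hc : S ⊆ ⋃ i, U i) :
    ∃ V : ι → Set X, (∀ i, IsOpen (V i)) ∧ (∀ i, V i ⊆ U i) ∧ S ⊆ ⋃ i, V i ∧
      ∀ x, {i | x ∈ V i}.encard ≤ n := by
  obtain ⟨V, hVo, hVU, hVc, hVn⟩ := h ι U hU hc
  obtain ⟨W, hWc, hWo, hWV⟩ := exists_subset_iUnion_closure_subset hS hVo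
    (fun x _ => toFinite _) hVc
  -- The points lying in more than `n` of the closures `closure (W i)`.
  let T : Set X := ⋃ s ∈ {s : Set ι | (n : ℕ∞) < s.encard}, ⋂ i ∈ s, closure (W i)
  have hT : IsClosed T := by
    refine (toFinite _).isClosed_biUnion fun s _ => ?_
    exact isClosed_biInter fun i _ => isClosed_closure
  have hST : ∀ x ∈ S, x ∉ T := by
    intro x hx hxT
    obtain ⟨s, hs, hxs⟩ := mem_iUnion₂.1 hxT
    refine absurd (hVn x hx) (not_le.2 (lt_of_lt_of_le hs (encard_le_encard ?_)))
    intro i hi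
    exact hWV i (mem_iInter₂.1 hxs i hi)
  -- `T` is closed and misses `S`, so removing it keeps the sets open and covering.
  refine ⟨fun i => W i \ T, fun i => (hWo i).sdiff hT,
    fun i => sdiff_subset.trans (subset_closure.trans ((hWV i).trans (hVU i))), fun x hx => ?_,
    fun x => ?_⟩
  · obtain ⟨i, hi⟩ := mem_iUnion.1 (hWc hx)
    exact mem_iUnion.2 ⟨i, hi, hST x hx⟩
  · by_contra! hx
    have hne : {i | x ∈ W i \ T}.Nonempty := by
      rw [nonempty_iff_ne_empty]
      intro h0
      rw [h0, encard_empty] at hx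
      exact not_lt_zero hx
    obtain ⟨i, hi⟩ := hne
    exact hi.2 (mem_iUnion₂.2 ⟨_, hx, mem_iInter₂.2 fun j hj => subset_closure hj.1⟩)

/-- A compact Hausdorff space having a base of open sets whose frontiers have covering dimension
`< n` has covering dimension `< n + 1`. -/
theorem coverDimLT_univ_succ_of_frontier [CompactSpace X] [T2Space X] {n : ℕ}
    (h : ∀ (x : X) (V : Set X), IsOpen V → x ∈ V →
      ∃ W, IsOpen W ∧ x ∈ W ∧ W ⊆ V ∧ CoverDimLT (frontier W) n) :
    CoverDimLT (univ : Set X) (n + 1) := by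
  intro ι _ U hU hc
  -- Up to a closed set `K` of dimension `< n`, the space is covered by disjoint open `G i ⊆ U i`.
  have key : ∃ (K : Set X) (G : ι → Set X), univ ⊆ K ∪ ⋃ i, G i ∧ IsClosed K ∧ CoverDimLT K n ∧
      (∀ i, IsOpen (G i)) ∧ (∀ i, G i ⊆ U i) ∧ ∀ i j x, x ∈ G i → x ∈ G j → i = j := by
    have hfin : ∀ t : Finset X, ∀ W : X → Set X, ∀ r : X → ι, (∀ x, IsOpen (W x)) →
        (∀ x, W x ⊆ U (r x)) → (∀ x, CoverDimLT (frontier (W x)) n) →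
        ∃ (K : Set X) (G : ι → Set X), (⋃ x ∈ t, W x) ⊆ K ∪ ⋃ i, G i ∧ IsClosed K ∧
          CoverDimLT K n ∧ (∀ i, IsOpen (G i)) ∧ (∀ i, G i ⊆ U i) ∧
          ∀ i j x, x ∈ G i → x ∈ G j → i = j := by
      intro t W r hW hWU hWn
      classical
      induction t using Finset.induction_on with
      | empty =>
        refine ⟨∅, fun _ => ∅, by simp, isClosed_empty, ?_, by simp, by simp, by simp⟩
        exact fun κ _ O hO hOc => ⟨O, hO, fun i => Subset.rfl, hOc, by simp⟩
      | insert a t _ ih =>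
        obtain ⟨K, G, hKG, hK, hKn, hGo, hGU, hGd⟩ := ih
        -- `W a` is added to the set of index `r a`, after its closure is cut out of all the sets;
        -- only points of its frontier are lost.
        refine ⟨K ∪ frontier (W a), fun i => G i \ closure (W a) ∪ {z ∈ W a | r a = i}, ?_,
          hK.union isClosed_frontier, hKn.union (hWn a) hK isClosed_frontier, fun i => ?_,
          fun i => union_subset (sdiff_subset.trans (hGU i)) ?_, ?_⟩
        · have ha : ∀ x ∈ W a, x ∈ (K ∪ frontier (W a)) ∪
              ⋃ i, (G i \ closure (W a) ∪ {z ∈ W a | r a = i}) := fun x hx =>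
            Or.inr (mem_iUnion.2 ⟨r a, Or.inr ⟨hx, rfl⟩⟩)
          intro x hx
          rw [Finset.set_biUnion_insert] at hx
          rcases hx with hx | hx
          · exact ha x hx
          · by_cases hxW : x ∈ W a
            · exact ha x hxW
            · by_cases hxc : x ∈ closure (W a)
              · exact Or.inl (Or.inr ⟨hxc, by rwa [(hW a).interior_eq]⟩)
              · rcases hKG hx with hxK | hxG
                · exact Or.inl (Or.inl hxK)
                · obtain ⟨i, hi⟩ := mem_iUnion.1 hxG
                  exact Or.inr (mem_iUnion.2 ⟨i, Or.inl ⟨hi, hxc⟩⟩)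
        · refine ((hGo i).sdiff isClosed_closure).union ?_
          by_cases hi : r a = i
          · simpa [hi] using hW a
          · simp [hi]
        · rintro x ⟨hx, rfl⟩
          exact hWU a hx
        · rintro i j x (hi | hi) (hj | hj)
          · exact hGd i j x hi.1 hj.1
          · exact absurd (subset_closure hj.1) hi.2
          · exact absurd (subset_closure hi.1) hj.2
          · exact hi.2.symm.trans hj.2
    have hloc : ∀ x, ∃ (W : Set X) (i : ι), IsOpen W ∧ x ∈ W ∧ W ⊆ U i ∧
        CoverDimLT (frontier W) n := by
      intro x
      obtain ⟨i, hi⟩ := mem_iUnion.1 (hc (mem_univ x))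
      obtain ⟨W, h1, h2, h3, h4⟩ := h x (U i) (hU i) hi
      exact ⟨W, i, h1, h2, h3, h4⟩
    choose W r hWo hxW hWU hWn using hloc
    obtain ⟨t, ht⟩ := isCompact_univ.elim_finite_subcover W hWo
      (fun x _ => mem_iUnion.2 ⟨x, hxW x⟩)
    obtain ⟨K, G, hKG, hrest⟩ := hfin t W r hWo hWU hWn
    exact ⟨K, G, ht.trans hKG, hrest⟩
  obtain ⟨K, G, hKG, hK, hKn, hGo, hGU, hGd⟩ := key
  -- The multiplicity is at most `n` from a shrinking over `K`, plus one from the disjoint `G i`.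
  obtain ⟨V, hVo, hVU, hVc, hVn⟩ :=
    hKn.exists_forall_encard_le hK U hU ((subset_univ K).trans hc)
  refine ⟨fun i => V i ∪ G i, fun i => (hVo i).union (hGo i),
    fun i => union_subset (hVU i) (hGU i), fun x hx => ?_, fun x _ => ?_⟩
  · rcases hKG hx with hx | hx
    · obtain ⟨i, hi⟩ := mem_iUnion.1 (hVc hx)
      exact mem_iUnion.2 ⟨i, Or.inl hi⟩
    · obtain ⟨i, hi⟩ := mem_iUnion.1 hx
      exact mem_iUnion.2 ⟨i, Or.inr hi⟩
  · have h1 : {i | x ∈ G i}.encard ≤ 1 := by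
      rw [encard_le_one_iff]
      exact fun i j hi hj => hGd i j x hi hj
    have hsub : {i | x ∈ V i ∪ G i} = {i | x ∈ V i} ∪ {i | x ∈ G i} := rfl
    rw [hsub, Nat.cast_add, Nat.cast_one]
    exact (encard_union_le _ _).trans (add_le_add (hVn x) h1)

/-- The covering dimension of a compact Hausdorff space does not exceed that of its components. -/
theorem coverDimLT_univ_of_connectedComponent [CompactSpace X] [T2Space X] {n : ℕ}
    (h : ∀ x : X, CoverDimLT (connectedComponent x) n) : CoverDimLT (univ : Set X) n := by
  intro ι _ U hU hc
  -- Clopen sets over which a shrinking of multiplicity `≤ n` exists are stable under finite unions.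
  have key : ∃ Z : Set X, IsClopen Z ∧ univ ⊆ Z ∧ ∃ V : ι → Set X, (∀ i, IsOpen (V i)) ∧
      (∀ i, V i ⊆ U i) ∧ Z ⊆ ⋃ i, V i ∧ ∀ x ∈ Z, {i | x ∈ V i}.encard ≤ n := by
    refine isCompact_univ.induction_on (p := fun s => ∃ Z : Set X, IsClopen Z ∧ s ⊆ Z ∧
      ∃ V : ι → Set X, (∀ i, IsOpen (V i)) ∧ (∀ i, V i ⊆ U i) ∧ Z ⊆ ⋃ i, V i ∧
        ∀ x ∈ Z, {i | x ∈ V i}.encard ≤ n) ?_ ?_ ?_ ?_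
    · exact ⟨∅, isClopen_empty, Subset.rfl, U, hU, fun i => Subset.rfl, empty_subset _, by simp⟩
    · rintro s t hst ⟨Z, hZ, htZ, hV⟩
      exact ⟨Z, hZ, hst.trans htZ, hV⟩
    · rintro s t ⟨Z, hZ, hsZ, V, hVo, hVU, hVc, hVn⟩ ⟨Z', hZ', htZ', V', hVo', hVU', hVc', hVn'⟩
      refine ⟨Z ∪ Z', hZ.union hZ', union_subset_union hsZ htZ',
        fun i => V i ∩ Z ∪ V' i \ Z, fun i => ((hVo i).inter hZ.isOpen).union
          ((hVo' i).sdiff hZ.isClosed), fun i => union_subset (inter_subset_left.trans (hVU i))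
            (sdiff_subset.trans (hVU' i)), fun x hx => ?_, fun x hx => ?_⟩
      · by_cases hxZ : x ∈ Z
        · obtain ⟨i, hi⟩ := mem_iUnion.1 (hVc hxZ)
          exact mem_iUnion.2 ⟨i, Or.inl ⟨hi, hxZ⟩⟩
        · obtain ⟨i, hi⟩ := mem_iUnion.1 (hVc' (hx.resolve_left hxZ))
          exact mem_iUnion.2 ⟨i, Or.inr ⟨hi, hxZ⟩⟩
      · by_cases hxZ : x ∈ Z
        · refine (encard_le_encard ?_).trans (hVn x hxZ)
          rintro i (hi | hi)
          exacts [hi.1, absurd hxZ hi.2]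
        · refine (encard_le_encard ?_).trans (hVn' x (hx.resolve_left hxZ))
          rintro i (hi | hi)
          exacts [absurd hi.2 hxZ, hi.1]
    · intro x _
      obtain ⟨V, hVo, hVU, hVc, hVn⟩ := (h x).exists_forall_encard_le isClosed_connectedComponent
        U hU ((subset_univ _).trans hc)
      -- The component is the intersection of its clopen neighbourhoods, so by compactness one of
      -- them lies in the open set covered by the `V i`.
      obtain ⟨⟨Z, hZ, hxZ⟩, hZV⟩ : ∃ Z : {s : Set X // IsClopen s ∧ x ∈ s}, Z.1 ⊆ ⋃ i, V i := by
        rw [connectedComponent_eq_iInter_isClopen] at hVc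
        have : Nonempty {s : Set X // IsClopen s ∧ x ∈ s} :=
          ⟨⟨univ, isClopen_univ, mem_univ x⟩⟩
        obtain ⟨Z, hZ⟩ := exists_subset_nhds_of_compactSpace
          (V := fun s : {s : Set X // IsClopen s ∧ x ∈ s} => s.1)
          (fun s t => ⟨⟨s.1 ∩ t.1, s.2.1.inter t.2.1, s.2.2, t.2.2⟩, inter_subset_left,
            inter_subset_right⟩)
          (fun s => s.2.1.isClosed) (U := ⋃ i, V i)
          (fun z hz => (isOpen_iUnion hVo).mem_nhds (hVc hz))
        exact ⟨Z, hZ⟩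
      exact ⟨Z, mem_nhdsWithin_of_mem_nhds (hZ.isOpen.mem_nhds hxZ), Z, hZ, Subset.rfl, V, hVo, hVU,
        hZV, fun z _ => hVn z⟩
  obtain ⟨Z, -, hZ, V, hVo, hVU, hVc, hVn⟩ := key
  exact ⟨V, hVo, hVU, hZ.trans hVc, fun x hx => hVn x (hZ hx)⟩

theorem IsClosed.coverDimLT_of_connectedComponentIn [CompactSpace X] [T2Space X] {S : Set X}
    (hS : IsClosed S) {n : ℕ} (h : ∀ x ∈ S, CoverDimLT (connectedComponentIn S x) n) :
    CoverDimLT S n := by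
  have := isCompact_iff_compactSpace.1 hS.isCompact
  rw [← hasCoveringDimensionLT_coe_iff, hasCoveringDimensionLT_iff_coverDimLT_univ]
  refine coverDimLT_univ_of_connectedComponent fun x => ?_
  rw [← IsInducing.subtypeVal.coverDimLT_image_iff, ← connectedComponentIn_eq_image x.2]
  exact h x x.2

end Cover

/-! ### Monotonicity of the small inductive dimension -/

/-- A space inducing its topology from a space with `ind < n` has `ind < n`; in particular `ind` is
monotone under passing to subspaces. -/
theorem Topology.IsInducing.hasSmallInductiveDimensionLT {n : ℕ} :
    ∀ {Z : Type u} {X : Type v} [TopologicalSpace Z] [TopologicalSpace X] {e : Z → X},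
      IsInducing e → HasSmallInductiveDimensionLT X n → HasSmallInductiveDimensionLT Z n := by
  induction n with
  | zero =>
    intro Z X _ _ e _ h
    rw [hasSmallInductiveDimensionLT_zero_iff] at h ⊢
    exact Function.isEmpty e
  | succ n ih =>
    intro Z X _ _ e he h
    cases h with | succ _ s hs hsn
    refine .succ n _ (hs.isInducing he) ?_
    rintro _ ⟨U, hU, rfl⟩
    have hmaps : MapsTo e (frontier (e ⁻¹' U)) (frontier U) :=
      he.continuous.frontier_preimage_subset U
    exact ih (e := hmaps.restrict e _ _) ((he.comp .subtypeVal).codRestrict fun a => hmaps a.2)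
      (hsn U hU)

/-! ### Ring-like maps -/

theorem IsRingLike.restrictPreimage {X : Type u} {Y : Type v} [TopologicalSpace X]
    [TopologicalSpace Y] {f : X → Y} (hf : IsRingLike f) (C : Set Y) :
    IsRingLike (C.restrictPreimage f) where
  continuous := hf.continuous.restrictPreimage
  isClosedMap := hf.isClosedMap.restrictPreimage C
  exists_isOpen := by
    rintro x _ _ ⟨U, hU, rfl⟩ hxU ⟨V, hV, rfl⟩ hxV
    obtain ⟨V', hV', hx, hVV, hfr⟩ := hf.exists_isOpen x U V hU hxU hV hxV
    refine ⟨Subtype.val ⁻¹' V', hV'.preimage continuous_subtype_val, hx, preimage_mono hVV, ?_⟩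
    intro z hz
    exact hfr (continuous_subtype_val.frontier_preimage_subset V' hz)

/-- For a ring-like map, and an open set `U` of the domain, a nondegenerate connected set of points
whose fibres lie neither in `U` nor in the exterior of `U` consists of points whose fibres lie in
the frontier of `U`: a fibre meeting `U` or its exterior gives arbitrarily small neighbourhoods
whose frontiers miss the connected set. -/
theorem IsRingLike.preimage_subset_frontier {X : Type u} {Y : Type v} [TopologicalSpace X]
    [TopologicalSpace Y] [T1Space Y] {f : X → Y} (hf : IsRingLike f) {U : Set X} (hU : IsOpen U)
    {C : Set Y} (hC : IsPreconnected C) (hCn : C.Nontrivial)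
    (hCU : ∀ y ∈ C, ¬ f ⁻¹' {y} ⊆ U) (hCU' : ∀ y ∈ C, ¬ f ⁻¹' {y} ⊆ (closure U)ᶜ) :
    f ⁻¹' C ⊆ frontier U := by
  have key : ∀ O : Set X, IsOpen O → (∀ y ∈ C, ¬ f ⁻¹' {y} ⊆ O) → ∀ x, f x ∈ C → x ∉ O := by
    intro O hO hCO x hxC hxO
    obtain ⟨y, hyC, hyx⟩ := hCn.exists_ne (f x)
    obtain ⟨V, hV, hxV, hVy, hfr⟩ := hf.exists_isOpen x O {y}ᶜ hO hxO isOpen_compl_singleton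
      (fun h => hyx h.symm)
    obtain ⟨z, hzC, hz⟩ : ∃ z ∈ C, z ∈ frontier V := by
      by_contra! hCV
      have hsub : C ⊆ V ∪ (closure V)ᶜ := by
        intro z hz
        by_contra h
        rw [mem_union, not_or, notMem_compl_iff] at h
        exact hCV z hz ⟨h.2, by rw [hV.interior_eq]; exact h.1⟩
      have hyV : y ∉ V := fun h => hVy h rfl
      obtain ⟨z, -, hzV, hzV'⟩ := hC V _ hV isClosed_closure.isOpen_compl hsub
        ⟨f x, hxC, hxV⟩ ⟨y, hyC, (hsub hyC).resolve_left hyV⟩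
      exact hzV' (subset_closure hzV)
    exact hCO z hzC ((preimage_mono (singleton_subset_iff.2 hz)).trans hfr)
  intro x hx
  refine ⟨?_, ?_⟩
  · by_contra h
    exact key _ isClosed_closure.isOpen_compl hCU' x hx h
  · rw [hU.interior_eq]
    exact key U hU hCU x hx

/-- The case of finite values: if `dim Y > k` and all fibres have `ind ≥ m`, then
`ind X ≥ k + m`. -/
theorem IsRingLike.not_hasSmallInductiveDimensionLT (k m : ℕ) :
    ∀ {X : Type u} {Y : Type v} [TopologicalSpace X] [CompactSpace X] [T2Space X]
      [TopologicalSpace Y] [CompactSpace Y] [T2Space Y] {f : X → Y}, IsRingLike f →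
      Function.Surjective f → ¬ HasCoveringDimensionLT Y (k + 1) →
      (∀ y, ¬ HasSmallInductiveDimensionLT (f ⁻¹' {y}) m) →
      ¬ HasSmallInductiveDimensionLT X (k + m) := by
  induction k with
  | zero =>
    intro X Y _ _ _ _ _ _ f hf hsurj hY hm hX
    have hne : Nonempty Y := by
      by_contra hempty
      rw [not_nonempty_iff] at hempty
      refine hY (CoverDimLT.hasCoveringDimensionLT ?_)
      exact subsingleton_univ.coverDimLT
    obtain ⟨y⟩ := hne
    rw [zero_add] at hX
    exact hm y (IsInducing.subtypeVal.hasSmallInductiveDimensionLT hX)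
  | succ k ih =>
    intro X Y _ _ _ _ _ _ f hf hsurj hY hm hX
    rw [hasCoveringDimensionLT_iff_coverDimLT_univ] at hY
    obtain ⟨y, V, hV, hyV, hyW⟩ : ∃ (y : Y) (V : Set Y), IsOpen V ∧ y ∈ V ∧
        ∀ W, IsOpen W → y ∈ W → W ⊆ V → ¬ CoverDimLT (frontier W) (k + 1) := by
      by_contra! h
      exact hY (coverDimLT_univ_succ_of_frontier h)
    obtain ⟨x, rfl⟩ := hsurj y
    rw [show k + 1 + m = k + m + 1 by omega] at hX
    cases hX with | succ _ s hs hsn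
    obtain ⟨U, hUs, hxU, hUV⟩ := hs.exists_subset_of_mem_open (u := f ⁻¹' V) hyV
      (hV.preimage hf.continuous)
    have hU := hs.isOpen hUs
    -- `A` and `B` consist of the points whose fibres lie in `U` and in the exterior of `U`.
    set A : Set Y := kernImage f U
    set B : Set Y := kernImage f (closure U)ᶜ
    have hAo : IsOpen A := isClosedMap_iff_kernImage.1 hf.isClosedMap hU
    have hBo : IsOpen B := isClosedMap_iff_kernImage.1 hf.isClosedMap
      isClosed_closure.isOpen_compl
    have hAB : Disjoint A B := by
      rw [disjoint_left]
      intro z hzA hzB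
      obtain ⟨w, rfl⟩ := hsurj z
      exact hzB rfl (subset_closure (hzA rfl))
    obtain ⟨V', hV', hxV', hV'V, hfr⟩ := hf.exists_isOpen x U V hU hxU hV hyV
    have hfrA : frontier V' ⊆ A := subset_kernImage_iff.2 hfr
    have hAV : A ⊆ V := by
      intro z hz
      obtain ⟨w, rfl⟩ := hsurj z
      exact hUV (hz rfl)
    -- Adding `A` to `V'` swallows the frontier of `V'`, so only the frontier of `A` remains.
    have hfrW : frontier (V' ∪ A) ⊆ (A ∪ B)ᶜ := by
      rintro z ⟨hzc, hzi⟩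
      rw [(hV'.union hAo).interior_eq] at hzi
      rw [closure_union] at hzc
      have hzA : z ∉ A := fun h => hzi (Or.inr h)
      rintro (h | h)
      · exact hzA h
      · rcases hzc with hz | hz
        · refine hzA (hfrA ⟨hz, ?_⟩)
          rw [hV'.interior_eq]
          exact fun h => hzi (Or.inl h)
        · exact (hAB.closure_left hBo).le_bot ⟨hz, h⟩
    have hP : IsClosed (A ∪ B)ᶜ := (hAo.union hBo).isClosed_compl
    have hPn : ¬ CoverDimLT (A ∪ B)ᶜ (k + 1) := fun h =>
      hyW (V' ∪ A) (hV'.union hAo) (Or.inl hxV') (union_subset hV'V hAV)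
        (h.of_subset hfrW isClosed_frontier)
    obtain ⟨z, hz, hzn⟩ : ∃ z ∈ (A ∪ B)ᶜ,
        ¬ CoverDimLT (connectedComponentIn (A ∪ B)ᶜ z) (k + 1) := by
      by_contra! h
      exact hPn (hP.coverDimLT_of_connectedComponentIn h)
    set C := connectedComponentIn (A ∪ B)ᶜ z
    have hCP : C ⊆ (A ∪ B)ᶜ := connectedComponentIn_subset _ _
    have hCc : IsClosed C := closure_subset_iff_isClosed.1
      (isPreconnected_connectedComponentIn.closure.subset_connectedComponentIn
        (subset_closure (mem_connectedComponentIn hz)) (closure_minimal hCP hP))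
    have hCnt : C.Nontrivial := by
      rw [← not_subsingleton_iff]
      exact fun h => hzn (h.coverDimLT.mono (by omega))
    have hCU : f ⁻¹' C ⊆ frontier U := by
      refine hf.preimage_subset_frontier hU isPreconnected_connectedComponentIn hCnt ?_ ?_
      · exact fun w hw h => hCP hw (Or.inl (subset_kernImage_iff.2 h rfl))
      · exact fun w hw h => hCP hw (Or.inr (subset_kernImage_iff.2 h rfl))
    have := isCompact_iff_compactSpace.1 hCc.isCompact
    have := isCompact_iff_compactSpace.1 (hCc.preimage hf.continuous).isCompact
    refine ih (hf.restrictPreimage C) (hsurj.restrictPreimage C)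
      (by rwa [hasCoveringDimensionLT_coe_iff]) (fun w hw => hm w.1 ?_)
      ((IsEmbedding.inclusion hCU).isInducing.hasSmallInductiveDimensionLT (hsn U hUs))
    -- The fibres of the restricted map are those of `f`.
    let e : f ⁻¹' {w.1} → C.restrictPreimage f ⁻¹' {w} := fun a =>
      ⟨⟨a.1, by rw [mem_preimage, a.2]; exact w.2⟩, Subtype.ext a.2⟩
    have he : IsInducing e := by
      refine IsInducing.of_comp (g := fun b => b.1.1) ?_ ?_ IsInducing.subtypeVal
      · fun_prop
      · fun_prop
    exact he.hasSmallInductiveDimensionLT hw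

theorem mainTheorem9 {X Y : Type*} [TopologicalSpace X] [CompactSpace X] [T2Space X]
    [TopologicalSpace Y] [CompactSpace Y] [T2Space Y] (f : X → Y) (hf : IsRingLike f)
    (hsurj : Function.Surjective f) (hY : 1 ≤ coveringDimension Y) (m : ℕ∞)
    (hm : ∀ y : Y, (m : WithBot ℕ∞) ≤ smallInductiveDimension (f ⁻¹' {y})) :
    coveringDimension Y + (m : WithBot ℕ∞) ≤ smallInductiveDimension X + 1 := by
  have key : ∀ k l : ℕ, ((k + 1 : ℕ) : WithBot ℕ∞) ≤ coveringDimension Y → (l : ℕ∞) ≤ m →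
      ((k + l : ℕ) : WithBot ℕ∞) ≤ smallInductiveDimension X := by
    intro k l hk hl
    rw [← not_lt, smallInductiveDimension_lt_iff]
    refine hf.not_hasSmallInductiveDimensionLT k l hsurj
      (fun h => (coveringDimension_lt_of_hasCoveringDimensionLT h).not_ge hk) fun y hy => ?_
    rw [← smallInductiveDimension_lt_iff] at hy
    refine hy.not_ge (le_trans ?_ (hm y))
    exact_mod_cast hl
  generalize coveringDimension Y = d at *
  generalize smallInductiveDimension X = b at *
  have hb : ((0 : ℕ) : WithBot ℕ∞) ≤ b := key 0 0 (by exact_mod_cast hY) (by simp)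
  induction d with
  | bot => simp at hY
  | coe d =>
  induction b with
  | bot => simp at hb
  | coe b =>
  have key' : ∀ k l : ℕ, ((k + 1 : ℕ) : ℕ∞) ≤ d → (l : ℕ∞) ≤ m → ((k + l : ℕ) : ℕ∞) ≤ b := by
    intro k l hk hl
    exact_mod_cast key k l (by exact_mod_cast hk) hl
  have hd : 1 ≤ d := by exact_mod_cast hY
  suffices d + m ≤ b + 1 by exact_mod_cast this
  induction b with
  | top => simp
  | coe b =>
  have hd' : d ≠ ⊤ := by
    rintro rfl
    have := key' (b + 1) 0 le_top (by simp)
    norm_cast at this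
    omega
  have hm' : m ≠ ⊤ := by
    rintro rfl
    have := key' 0 (b + 1) (by simpa using hd) le_top
    norm_cast at this
    omega
  lift d to ℕ using hd'
  lift m to ℕ using hm'
  norm_cast at hd ⊢
  have := key' (d - 1) m (by norm_cast; omega) le_rfl
  norm_cast at this
  omega
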